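/- For a pure three-qubit state $|\varphi\rangle=\sum_{i,j,k\in\{0,1\}}a_{ijk}|ijk\rangle$ put $\tau_3(|\varphi\rangle)=\sqrt{\mu_3}$, $\mu_3=4|d_1-2d_2+4d_3|$, where $$d_1=a_{000}^2a_{111}^2+a_{001}^2a_{110}^2+a_{010}^2a_{101}^2+a_{100}^2a_{011}^2,$$ $$d_2=a_{000}a_{111}a_{011}a_{100}+a_{000}a_{111}a_{101}a_{010}+a_{000}a_{111}a_{110}a_{001}+a_{011}a_{100}a_{101}a_{010}+a_{011}a_{100}a_{110}a_{001}+a_{101}a_{010}a_{110}a_{001},$$ $$d_3=a_{000}a_{110}a_{101}a_{011}+a_{111}a_{001}a_{010}a_{100}.$$ For a three-qubit density operator $\rho$ (not necessarily normalized) let $\tau_3(\rho)$ and $\tau_a(\rho)$ be the infimum and the supremum of $\sum_i p_i\tau_3(|\pi_i\rangle)$ over all finite realizations $\rho=\sum_i p_i|\pi_i\rangle\langle\pi_i|$ with $p_i\ge 0$ and unit vectors $|\pi_i\rangle$. For a four-qubit vector $|\psi\rangle$ and a qubit $k\in\{1,2,3,4\}$ let $\rho^{(k)}$ be the partial trace of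 $|\psi\rangle\langle\psi|$ over qubit $k$ and $\tau_4^{(k)}(\psi)=\sqrt{\tau_a(\rho^{(k)})^2-\tau_3(\rho^{(k)})^2}$; write $\tau_4=\tau_4^{(1)}$. Consider the (unnormalized) standard states of the nine SLOCC families of four qubits, with complex parameters unless stated otherwise: $$\begin{aligned} G_{abcd}&=\tfrac{a+d}{2}(|0000\rangle+|1111\rangle)+\tfrac{a-d}{2}(|0011\rangle+|1100\rangle)+\tfrac{b+c}{2}(|0101\rangle+|1010\rangle)+\tfrac{b-c}{2}(|0110\rangle+|1001\rangle),\\ L_{abc_2}&=\tfrac{a+b}{2}(|0000\rangle+|1111\rangle)+\tfrac{a-b}{2}(|0011\rangle+|1100\rangle)+c(|0101\rangle+|1010\rangle)+|0110\rangle,\\ L_{a_2b_2}&=a(|0000\rangle+|1111\rangle)+b(|0101\rangle+|1010\rangle)+|0110\rangle+|0011\rangle,\\ L_{ab_3}&=a(|0000\rangle+|1111\rangle)+\tfrac{a+b}{2}(|0101\rangle+|1010\rangle)+\tfrac{i}{\sqrt2}(|0001\rangle+|0010\rangle+|0111\rangle+|1011\rangle)+\tfrac{a-b}{2}(|0110\rangle+|1001\rangle),\\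 L_{a_4}&=a(|0000\rangle+|0101\rangle+|1010\rangle+|1111\rangle)+i|0001\rangle+|0110\rangle-|1011\rangle,\\ L_{a_20_{3\oplus1}}&=a(|0000\rangle+|1111\rangle)+|0011\rangle+|0101\rangle+|0110\rangle,\\ L_{0_{5\oplus\bar3}}&=|0000\rangle+|0101\rangle+|1000\rangle+|1110\rangle,\\ L_{0_{7\oplus\bar1}}&=|0000\rangle+|1011\rangle+|1101\rangle+|1110\rangle,\\ L_{0_{3\oplus\bar1}0_{3\oplus\bar1}}&=|0000\rangle+|0111\rangle. \end{aligned}$$ Then: 1. $\tau_4(G_{abcd})=0$ if $a,b,c,d$ are real with $|a|=|b|=|c|=|d|$, and more generally if $a,b,c,d$ are complex and $b,c,d\in\{a,-a\}$; also $\tau_4(G_{abcd})=0$ whenever at least three of the complex numbers $a,b,c,d$ vanish. 2. $\tau_4(L_{abc_2})=0$ if $a,b,c$ are real and $|a|=|c|$ or $|b|=|c|$, and more generally if $a,b,c$ are complex and $a=\pm c$ or $b=\pm c$. 3. $\tau_4(L_{a_2b_2})=0$ if $a,b$ are real and $|a|=|b|$, and more generally if $a,b$ are complex and $a=\pm b$.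 4. $\tau_4(L_{ab_3})=0$ for all complex $a,b$ with $|a|=|b|$. The state $|W_4\rangle=\frac12(|0001\rangle+|0010\rangle+|0100\rangle+|1000\rangle)$ is obtained from $L_{ab_3}$ with $a=b=0$ by a product of four invertible local operators, and $\tau_4(|W_4\rangle)=0$. 5. $\tau_4(L_{a_4})=0$ and $\tau_4(L_{a_20_{3\oplus1}})=0$ if $a=0$. 6. $\tau_4(L_{0_{5\oplus\bar3}})=0$ and $\tau_4(L_{0_{3\oplus\bar1}0_{3\oplus\bar1}})=0$. 7. $\tau_4(L_{0_{7\oplus\bar1}})\ne0$, whereas $\tau_4^{(k)}(L_{0_{7\oplus\bar1}})=0$ for $k=2,3,4$. -/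

import Mathlib

noncomputable section

namespace FourQubit

/-- The Hilbert space `(ℂ²)^{⊗ n}` of `n` qubits; the coordinate of a vector at
`v : Fin n → Fin 2` is its amplitude on the computational basis ket `|v 0, v 1, …⟩`. -/
abbrev Qubits (n : ℕ) : Type := EuclideanSpace ℂ (Fin n → Fin 2)

/-- Operators on `n` qubits, as matrices in the computational basis. -/
abbrev Op (n : ℕ) : Type := Matrix (Fin n → Fin 2) (Fin n → Fin 2) ℂ

/-- `|φ⟩⟨φ|`. -/
def proj {n : ℕ} (φ : Qubits n) : Op n := fun i j => φ i * starRingEnd ℂ (φ j)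

/-- The partial trace over the qubit `k` (qubits are numbered from `0`); the other qubits keep
their order. -/
def partialTrace {n : ℕ} (k : Fin (n + 1)) (ρ : Op (n + 1)) : Op n := fun i j =>
  ∑ s : Fin 2, ρ (k.insertNth (α := fun _ => Fin 2) s i) (k.insertNth (α := fun _ => Fin 2) s j)

/-! ### The three-tangle of a pure three-qubit state -/

/-- The amplitude `a_{ijk}`. -/
def amp (φ : Qubits 3) (i j k : Fin 2) : ℂ := φ ![i, j, k]

def d₁ (φ : Qubits 3) : ℂ :=
  amp φ 0 0 0 ^ 2 * amp φ 1 1 1 ^ 2 + amp φ 0 0 1 ^ 2 * amp φ 1 1 0 ^ 2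
    + amp φ 0 1 0 ^ 2 * amp φ 1 0 1 ^ 2 + amp φ 1 0 0 ^ 2 * amp φ 0 1 1 ^ 2

def d₂ (φ : Qubits 3) : ℂ :=
  amp φ 0 0 0 * amp φ 1 1 1 * amp φ 0 1 1 * amp φ 1 0 0
    + amp φ 0 0 0 * amp φ 1 1 1 * amp φ 1 0 1 * amp φ 0 1 0
    + amp φ 0 0 0 * amp φ 1 1 1 * amp φ 1 1 0 * amp φ 0 0 1
    + amp φ 0 1 1 * amp φ 1 0 0 * amp φ 1 0 1 * amp φ 0 1 0
    + amp φ 0 1 1 * amp φ 1 0 0 * amp φ 1 1 0 * amp φ 0 0 1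
    + amp φ 1 0 1 * amp φ 0 1 0 * amp φ 1 1 0 * amp φ 0 0 1

def d₃ (φ : Qubits 3) : ℂ :=
  amp φ 0 0 0 * amp φ 1 1 0 * amp φ 1 0 1 * amp φ 0 1 1
    + amp φ 1 1 1 * amp φ 0 0 1 * amp φ 0 1 0 * amp φ 1 0 0

/-- The three-tangle `μ₃ = 4 |d₁ - 2 d₂ + 4 d₃|`. -/
def mu₃ (φ : Qubits 3) : ℝ := 4 * ‖d₁ φ - 2 * d₂ φ + 4 * d₃ φ‖

/-- `τ₃ = √μ₃` on pure states. -/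
def tau₃Pure (φ : Qubits 3) : ℝ := Real.sqrt (mu₃ φ)

/-! ### Mixed states -/

/-- `{p i, π i}` is a realization of `ρ`: `ρ = ∑ p i |π i⟩⟨π i|` with unit vectors `π i` and
weights `p i ≥ 0`. Taking traces, `∑ p i = tr ρ`, so the weights are probabilities when `ρ` is
normalized; when `ρ` is not normalized, they sum to its trace. -/
def IsRealization {n m : ℕ} (ρ : Op n) (p : Fin m → ℝ) (π : Fin m → Qubits n) : Prop :=
  (∀ i, 0 ≤ p i) ∧ (∀ i, ‖π i‖ = 1) ∧ ρ = ∑ i, (p i : ℂ) • proj (π i)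

/-- All averages `∑ p i τ₃(π i)` over the (finite) realizations of `ρ`. -/
def averages (ρ : Op 3) : Set ℝ :=
  {t | ∃ (m : ℕ) (p : Fin m → ℝ) (π : Fin m → Qubits 3),
    IsRealization ρ p π ∧ t = ∑ i, p i * tau₃Pure (π i)}

/-- The three-tangle of a mixed state (convex roof). -/
def tau₃ (ρ : Op 3) : ℝ := sInf (averages ρ)

/-- The three-tangle of assistance. -/
def tauA (ρ : Op 3) : ℝ := sSup (averages ρ)

/-- `τ₄` of the four-qubit vector `ψ`, computed by tracing out the qubit `k`. -/
def tau₄ (k : Fin 4) (ψ : Qubits 4) : ℝ :=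
  Real.sqrt (tauA (partialTrace k (proj ψ)) ^ 2 - tau₃ (partialTrace k (proj ψ)) ^ 2)

/-! ### The infimum, the supremum and the square root above are taken over sensible data -/

theorem tau₃Pure_nonneg (φ : Qubits 3) : 0 ≤ tau₃Pure φ := Real.sqrt_nonneg _

theorem averages_nonneg {ρ : Op 3} {t : ℝ} (ht : t ∈ averages ρ) : 0 ≤ t := by
  obtain ⟨m, p, π, ⟨hp, -, -⟩, rfl⟩ := ht
  exact Finset.sum_nonneg fun i _ => mul_nonneg (hp i) (tau₃Pure_nonneg _)

theorem bddBelow_averages (ρ : Op 3) : BddBelow (averages ρ) :=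
  ⟨0, fun _ ht => averages_nonneg ht⟩

theorem proj_smul {n : ℕ} (c : ℝ) (φ : Qubits n) :
    proj ((c : ℂ) • φ) = ((c ^ 2 : ℝ) : ℂ) • proj φ := by
  ext i j
  simp [proj]
  ring

theorem exists_unit_proj {n : ℕ} (φ : Qubits n) :
    ∃ π : Qubits n, ‖π‖ = 1 ∧ proj φ = ((‖φ‖ ^ 2 : ℝ) : ℂ) • proj π := by
  by_cases h : φ = 0
  · refine ⟨EuclideanSpace.single 0 1, by simp, ?_⟩
    subst h
    ext i j
    simp [proj]
  · have h0 : ‖φ‖ ≠ 0 := norm_ne_zero_iff.mpr h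
    refine ⟨((‖φ‖⁻¹ : ℝ) : ℂ) • φ, ?_, ?_⟩
    · rw [norm_smul]
      simp [h0]
    · rw [proj_smul, smul_smul, ← Complex.ofReal_mul, ← mul_pow, mul_inv_cancel₀ h0]
      simp

theorem averages_nonempty (k : Fin 4) (ψ : Qubits 4) :
    (averages (partialTrace k (proj ψ))).Nonempty := by
  let φ : Fin 2 → Qubits 3 := fun s =>
    WithLp.toLp 2 fun i => ψ (k.insertNth (α := fun _ => Fin 2) s i)
  choose π hπ hφ using fun s => exists_unit_proj (φ s)
  refine ⟨_, 2, fun s => ‖φ s‖ ^ 2, π, ⟨fun s => by positivity, hπ, ?_⟩, rfl⟩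
  rw [Finset.sum_congr rfl fun s _ => (hφ s).symm]
  ext i j
  simp [partialTrace, proj, φ]

theorem trace_proj {n : ℕ} (φ : Qubits n) : (proj φ).trace = ((‖φ‖ ^ 2 : ℝ) : ℂ) := by
  rw [EuclideanSpace.norm_sq_eq]
  simp [Matrix.trace, proj, Complex.mul_conj']

theorem IsRealization.sum_eq {n m : ℕ} {ρ : Op n} {p : Fin m → ℝ} {π : Fin m → Qubits n}
    (h : IsRealization ρ p π) : ∑ i, p i = ρ.trace.re := by
  obtain ⟨-, h1, rfl⟩ := h
  simp [Matrix.trace_sum, Matrix.trace_smul, trace_proj, h1]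

theorem norm_amp_le (φ : Qubits 3) (h : ‖φ‖ = 1) (i j k : Fin 2) : ‖amp φ i j k‖ ≤ 1 :=
  h ▸ PiLp.norm_apply_le φ _

theorem tau₃Pure_le (φ : Qubits 3) (h : ‖φ‖ = 1) : tau₃Pure φ ≤ 10 := by
  have H := norm_amp_le φ h
  have h4 : ∀ x y z w : ℂ, ‖x‖ ≤ 1 → ‖y‖ ≤ 1 → ‖z‖ ≤ 1 → ‖w‖ ≤ 1 → ‖x * y * z * w‖ ≤ 1 := by
    intro x y z w hx hy hz hw
    simp only [norm_mul]
    exact mul_le_one₀ (mul_le_one₀ (mul_le_one₀ hx (norm_nonneg _) hy) (norm_nonneg _) hz)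
      (norm_nonneg _) hw
  have h2 : ∀ x y : ℂ, ‖x‖ ≤ 1 → ‖y‖ ≤ 1 → ‖x ^ 2 * y ^ 2‖ ≤ 1 := by
    intro x y hx hy
    simpa [pow_two, mul_assoc] using h4 x x y y hx hx hy hy
  have e1 : ‖d₁ φ‖ ≤ 4 := by
    refine (norm_add₄_le).trans ?_
    linarith [h2 _ _ (H 0 0 0) (H 1 1 1), h2 _ _ (H 0 0 1) (H 1 1 0),
      h2 _ _ (H 0 1 0) (H 1 0 1), h2 _ _ (H 1 0 0) (H 0 1 1)]
  have e2 : ‖d₂ φ‖ ≤ 6 := by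
    refine (norm_add_le _ _).trans ?_
    refine (add_le_add (norm_add_le _ _) le_rfl).trans ?_
    refine (add_le_add (add_le_add norm_add₄_le le_rfl) le_rfl).trans ?_
    linarith [h4 _ _ _ _ (H 0 0 0) (H 1 1 1) (H 0 1 1) (H 1 0 0),
      h4 _ _ _ _ (H 0 0 0) (H 1 1 1) (H 1 0 1) (H 0 1 0),
      h4 _ _ _ _ (H 0 0 0) (H 1 1 1) (H 1 1 0) (H 0 0 1),
      h4 _ _ _ _ (H 0 1 1) (H 1 0 0) (H 1 0 1) (H 0 1 0),
      h4 _ _ _ _ (H 0 1 1) (H 1 0 0) (H 1 1 0) (H 0 0 1),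
      h4 _ _ _ _ (H 1 0 1) (H 0 1 0) (H 1 1 0) (H 0 0 1)]
  have e3 : ‖d₃ φ‖ ≤ 2 := by
    refine (norm_add_le _ _).trans ?_
    linarith [h4 _ _ _ _ (H 0 0 0) (H 1 1 0) (H 1 0 1) (H 0 1 1),
      h4 _ _ _ _ (H 1 1 1) (H 0 0 1) (H 0 1 0) (H 1 0 0)]
  have e : mu₃ φ ≤ 10 ^ 2 := by
    have a1 := norm_add_le (d₁ φ - 2 * d₂ φ) (4 * d₃ φ)
    have a2 := norm_sub_le (d₁ φ) (2 * d₂ φ)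
    simp only [norm_mul, Complex.norm_ofNat] at a1 a2
    unfold mu₃
    linarith
  exact Real.sqrt_le_iff.mpr ⟨by norm_num, e⟩

theorem bddAbove_averages (ρ : Op 3) : BddAbove (averages ρ) := by
  refine ⟨ρ.trace.re * 10, ?_⟩
  rintro _ ⟨m, p, π, h, rfl⟩
  rw [← h.sum_eq, Finset.sum_mul]
  exact Finset.sum_le_sum fun i _ =>
    mul_le_mul_of_nonneg_left (tau₃Pure_le _ (h.2.1 i)) (h.1 i)

theorem tau₃_nonneg (ρ : Op 3) : 0 ≤ tau₃ ρ := Real.sInf_nonneg fun _ ht => averages_nonneg ht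

theorem tau₃_le_tauA (k : Fin 4) (ψ : Qubits 4) :
    tau₃ (partialTrace k (proj ψ)) ≤ tauA (partialTrace k (proj ψ)) :=
  csInf_le_csSup (averages_nonempty k ψ) (bddBelow_averages _) (bddAbove_averages _)

/-! ### The standard states of the nine families -/

/-- The ket `|i j k l⟩`. -/
def ket (i j k l : Fin 2) : Qubits 4 := EuclideanSpace.single ![i, j, k, l] 1

def Gabcd (a b c d : ℂ) : Qubits 4 :=
  ((a + d) / 2) • (ket 0 0 0 0 + ket 1 1 1 1) + ((a - d) / 2) • (ket 0 0 1 1 + ket 1 1 0 0)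
    + ((b + c) / 2) • (ket 0 1 0 1 + ket 1 0 1 0) + ((b - c) / 2) • (ket 0 1 1 0 + ket 1 0 0 1)

def Labc2 (a b c : ℂ) : Qubits 4 :=
  ((a + b) / 2) • (ket 0 0 0 0 + ket 1 1 1 1) + ((a - b) / 2) • (ket 0 0 1 1 + ket 1 1 0 0)
    + c • (ket 0 1 0 1 + ket 1 0 1 0) + ket 0 1 1 0

def La2b2 (a b : ℂ) : Qubits 4 :=
  a • (ket 0 0 0 0 + ket 1 1 1 1) + b • (ket 0 1 0 1 + ket 1 0 1 0) + ket 0 1 1 0 + ket 0 0 1 1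

def Lab3 (a b : ℂ) : Qubits 4 :=
  a • (ket 0 0 0 0 + ket 1 1 1 1) + ((a + b) / 2) • (ket 0 1 0 1 + ket 1 0 1 0)
    + (Complex.I / (Real.sqrt 2 : ℂ)) • (ket 0 0 0 1 + ket 0 0 1 0 + ket 0 1 1 1 + ket 1 0 1 1)
    + ((a - b) / 2) • (ket 0 1 1 0 + ket 1 0 0 1)

def La4 (a : ℂ) : Qubits 4 :=
  a • (ket 0 0 0 0 + ket 0 1 0 1 + ket 1 0 1 0 + ket 1 1 1 1)
    + (Complex.I • ket 0 0 0 1 + ket 0 1 1 0 - ket 1 0 1 1)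

/-- `L_{a₂ 0_{3⊕1}}`. -/
def La2031 (a : ℂ) : Qubits 4 :=
  a • (ket 0 0 0 0 + ket 1 1 1 1) + (ket 0 0 1 1 + ket 0 1 0 1 + ket 0 1 1 0)

/-- `L_{0_{5⊕3̄}}`. -/
def L053 : Qubits 4 := ket 0 0 0 0 + ket 0 1 0 1 + ket 1 0 0 0 + ket 1 1 1 0

/-- `L_{0_{7⊕1̄}}`. -/
def L071 : Qubits 4 := ket 0 0 0 0 + ket 1 0 1 1 + ket 1 1 0 1 + ket 1 1 1 0

/-- `L_{0_{3⊕1̄} 0_{3⊕1̄}}`. -/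
def L031031 : Qubits 4 := ket 0 0 0 0 + ket 0 1 1 1

/-- The four-qubit W state. -/
def W4 : Qubits 4 :=
  (1 / 2 : ℂ) • (ket 0 0 0 1 + ket 0 0 1 0 + ket 0 1 0 0 + ket 1 0 0 0)

/-- The action of the product operator `A 0 ⊗ A 1 ⊗ ⋯`. -/
def localOp {n : ℕ} (A : Fin n → Matrix (Fin 2) (Fin 2) ℂ) (ψ : Qubits n) : Qubits n :=
  WithLp.toLp 2 fun i => ∑ j : Fin n → Fin 2, (∏ q, A q (i q) (j q)) * ψ j

/-- Equivalence under stochastic local operations and classical communication: the vectors are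
related by a product of invertible local operators. -/
def SLOCCEquiv {n : ℕ} (ψ φ : Qubits n) : Prop :=
  ∃ A : Fin n → Matrix (Fin 2) (Fin 2) ℂ, (∀ q, IsUnit (A q).det) ∧ φ = localOp A ψ

end FourQubit

end

namespace FourQubit

/-! Tracing out one qubit leaves a sum of two projectors onto the slices `φ₀`, `φ₁`, so every vector
of a realization with nonzero weight is some `x φ₀ + y φ₁` (`IsRealization.mem_span`), and the
hyperdeterminant there is a binary quartic in `x, y`. When this quartic is `c` times the fourth
power of one coordinate, `τ₃` is a constant times the squared modulus of that coordinate, and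
averaging gives a diagonal entry of `ρ`, whatever the realization; infimum and supremum then agree
(`tau₄_eq_zero_of_hyperdet`). Each vanishing claim is such a quartic, possibly zero. For `L071` with
the first qubit traced out the quartic is `4 x y ^ 3`: the slices average to zero, while a Hadamard
rotation of them gives a positive average. -/

/-- Cayley's hyperdeterminant, whose modulus is a quarter of the three-tangle. -/
def hyperdet (φ : Qubits 3) : ℂ := d₁ φ - 2 * d₂ φ + 4 * d₃ φ

/-! ### Realizations and the criterion for `τ₄ = 0`. -/

/-- The part of `ψ` in which the qubit `k` is in the state `s`. -/
def slice {n : ℕ} (k : Fin (n + 1)) (ψ : Qubits (n + 1)) (s : Fin 2) : Qubits n :=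
  WithLp.toLp 2 fun i => ψ (k.insertNth (α := fun _ => Fin 2) s i)

theorem partialTrace_proj {n : ℕ} (k : Fin (n + 1)) (ψ : Qubits (n + 1)) :
    partialTrace k (proj ψ) = proj (slice k ψ 0) + proj (slice k ψ 1) := by
  ext i j
  simp [partialTrace, proj, slice]

/-- The quadratic form of a matrix. -/
def expect {n : ℕ} (v : Qubits n) : Op n →ₗ[ℂ] ℂ where
  toFun ρ := ∑ i, ∑ j, starRingEnd ℂ (v i) * ρ i j * v j
  map_add' ρ σ := by simp [mul_add, add_mul, Finset.sum_add_distrib]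
  map_smul' c ρ := by
    simp only [Matrix.smul_apply, smul_eq_mul, Finset.mul_sum, RingHom.id_apply]
    exact Finset.sum_congr rfl fun i _ => Finset.sum_congr rfl fun j _ => by ring

theorem expect_proj {n : ℕ} (v φ : Qubits n) :
    expect v (proj φ) = ((‖inner ℂ v φ‖ ^ 2 : ℝ) : ℂ) := by
  rw [Complex.ofReal_pow, ← Complex.mul_conj', PiLp.inner_apply, map_sum, Finset.sum_mul_sum]
  refine Finset.sum_congr rfl fun i _ => Finset.sum_congr rfl fun j _ => ?_
  simp [proj]
  ring

/-- The vectors of a realization lie in the range of the operator. -/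
theorem IsRealization.mem_span {n m : ℕ} {φ₀ φ₁ : Qubits n} {p : Fin m → ℝ}
    {π : Fin m → Qubits n} (h : IsRealization (proj φ₀ + proj φ₁) p π) {i : Fin m}
    (hi : p i ≠ 0) : π i ∈ Submodule.span ℂ {φ₀, φ₁} := by
  -- For `v` orthogonal to the span the expectation of the operator is zero, yet it is a sum of
  -- nonnegative terms `p l * ‖⟨v, π l⟩‖ ^ 2`.
  rw [← Submodule.orthogonal_orthogonal (Submodule.span ℂ {φ₀, φ₁}), Submodule.mem_orthogonal]
  intro v hv
  have h₀ : inner ℂ v φ₀ = 0 :=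
    Submodule.inner_left_of_mem_orthogonal (Submodule.subset_span (by simp)) hv
  have h₁ : inner ℂ v φ₁ = 0 :=
    Submodule.inner_left_of_mem_orthogonal (Submodule.subset_span (by simp)) hv
  have e := congrArg (expect v) h.2.2
  simp only [map_add, map_sum, map_smul, expect_proj, h₀, h₁, smul_eq_mul] at e
  have e' : ∑ l, p l * ‖inner ℂ v (π l)‖ ^ 2 = 0 := by
    have : ((∑ l, p l * ‖inner ℂ v (π l)‖ ^ 2 : ℝ) : ℂ) = 0 := by
      push_cast
      push_cast at e
      rw [← e]
      simp
    exact_mod_cast this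
  rw [Finset.sum_eq_zero_iff_of_nonneg fun l _ => mul_nonneg (h.1 l) (sq_nonneg _)] at e'
  simpa [hi] using e' i (Finset.mem_univ i)

theorem IsRealization.sum_coord {n m : ℕ} {ρ : Op n} {p : Fin m → ℝ} {π : Fin m → Qubits n}
    (h : IsRealization ρ p π) (j : Fin n → Fin 2) :
    ∑ i, p i * ‖π i j‖ ^ 2 = (ρ j j).re := by
  rw [h.2.2, Matrix.sum_apply, Complex.re_sum]
  refine Finset.sum_congr rfl fun i _ => ?_
  rw [Matrix.smul_apply, proj, Complex.mul_conj', smul_eq_mul, ← Complex.ofReal_pow,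
    ← Complex.ofReal_mul, Complex.ofReal_re]

/-- The square root in `τ₃` turns a quartic into a squared modulus, the quantity whose average
`IsRealization.sum_coord` computes. -/
theorem tau₃Pure_of_hyperdet {φ : Qubits 3} {c z : ℂ} (h : hyperdet φ = c * z ^ 4) :
    tau₃Pure φ = Real.sqrt (4 * ‖c‖) * ‖z‖ ^ 2 := by
  have e : mu₃ φ = 4 * ‖c‖ * (‖z‖ ^ 2) ^ 2 := by
    change 4 * ‖hyperdet φ‖ = _
    rw [h, norm_mul, norm_pow]
    ring
  rw [tau₃Pure, e, Real.sqrt_mul (by positivity), Real.sqrt_sq (by positivity)]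

/-- If the hyperdeterminant is the fourth power of a coordinate on the range of the reduced
operator, up to a constant, then all realizations have the same average. -/
theorem tau₄_eq_zero_of_hyperdet {k : Fin 4} {ψ : Qubits 4} (j : Fin 3 → Fin 2) (c : ℂ)
    (h : ∀ x y : ℂ, hyperdet (x • slice k ψ 0 + y • slice k ψ 1)
      = c * (x * slice k ψ 0 j + y * slice k ψ 1 j) ^ 4) :
    tau₄ k ψ = 0 := by
  have H : ∀ t ∈ averages (partialTrace k (proj ψ)),
      t = Real.sqrt (4 * ‖c‖) * (partialTrace k (proj ψ) j j).re := by
    rintro _ ⟨m, p, π, hr, rfl⟩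
    rw [← hr.sum_coord, Finset.mul_sum]
    refine Finset.sum_congr rfl fun i _ => ?_
    -- A vector of weight zero need not lie in the range.
    by_cases hi : p i = 0
    · simp [hi]
    rw [partialTrace_proj] at hr
    obtain ⟨x, y, hxy⟩ := Submodule.mem_span_pair.mp (hr.mem_span hi)
    have := tau₃Pure_of_hyperdet (h x y)
    rw [hxy] at this
    rw [this, ← hxy]
    simp only [PiLp.add_apply, PiLp.smul_apply, smul_eq_mul]
    ring
  have e : averages (partialTrace k (proj ψ)) =
      {Real.sqrt (4 * ‖c‖) * (partialTrace k (proj ψ) j j).re} :=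
    (averages_nonempty k ψ).subset_singleton_iff.mp H
  simp [tau₄, tauA, tau₃, e]

/-! ### The vanishing cases, family by family. -/

theorem insertNth_zero_vec (s i j l : Fin 2) :
    (0 : Fin 4).insertNth (α := fun _ => Fin 2) s ![i, j, l] = ![s, i, j, l] := by
  ext q; fin_cases q <;> rfl

theorem insertNth_one_vec (s i j l : Fin 2) :
    (1 : Fin 4).insertNth (α := fun _ => Fin 2) s ![i, j, l] = ![i, s, j, l] := by
  ext q; fin_cases q <;> rfl

theorem insertNth_two_vec (s i j l : Fin 2) :
    (2 : Fin 4).insertNth (α := fun _ => Fin 2) s ![i, j, l] = ![i, j, s, l] := by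
  ext q; fin_cases q <;> rfl

theorem insertNth_three_vec (s i j l : Fin 2) :
    (3 : Fin 4).insertNth (α := fun _ => Fin 2) s ![i, j, l] = ![i, j, l, s] := by
  ext q; fin_cases q <;> rfl

theorem ket_apply (i j k l a b c d : Fin 2) :
    ket i j k l ![a, b, c, d] = if i = a ∧ j = b ∧ k = c ∧ l = d then 1 else 0 := by
  simp [ket, eq_comm]

theorem amp_slice (k : Fin 4) (ψ : Qubits 4) (x y : ℂ) (a b c : Fin 2) :
    amp (x • slice k ψ 0 + y • slice k ψ 1) a b c =
      x * ψ (k.insertNth (α := fun _ => Fin 2) 0 ![a, b, c])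
        + y * ψ (k.insertNth (α := fun _ => Fin 2) 1 ![a, b, c]) := rfl

theorem slice_apply (k : Fin 4) (ψ : Qubits 4) (s : Fin 2) (v : Fin 3 → Fin 2) :
    slice k ψ s v = ψ (k.insertNth (α := fun _ => Fin 2) s v) := rfl

theorem tau₄_Gabcd_of_sq_eq {a b c d : ℂ} (hb : b = a ∨ b = -a) (hc : c = a ∨ c = -a)
    (hd : d = a ∨ d = -a) : tau₄ 0 (Gabcd a b c d) = 0 := by
  -- The quartic vanishes identically, so the chosen coordinate is irrelevant.
  refine tau₄_eq_zero_of_hyperdet ![0, 0, 0] 0 fun x y => ?_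
  simp only [hyperdet, d₁, d₂, d₃, amp_slice, insertNth_zero_vec, Gabcd, PiLp.add_apply,
    PiLp.smul_apply, ket_apply, smul_eq_mul]
  rcases hb with rfl | rfl <;> rcases hc with rfl | rfl <;> rcases hd with rfl | rfl <;>
    simp <;> ring

theorem tau₄_Gabcd_of_three_zero {a b c d : ℂ}
    (h : (b = 0 ∧ c = 0 ∧ d = 0) ∨ (a = 0 ∧ c = 0 ∧ d = 0) ∨
      (a = 0 ∧ b = 0 ∧ d = 0) ∨ (a = 0 ∧ b = 0 ∧ c = 0)) : tau₄ 0 (Gabcd a b c d) = 0 := by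
  refine tau₄_eq_zero_of_hyperdet ![0, 0, 0] 0 fun x y => ?_
  simp only [hyperdet, d₁, d₂, d₃, amp_slice, insertNth_zero_vec, Gabcd, PiLp.add_apply,
    PiLp.smul_apply, ket_apply, smul_eq_mul]
  rcases h with ⟨rfl, rfl, rfl⟩ | ⟨rfl, rfl, rfl⟩ | ⟨rfl, rfl, rfl⟩ | ⟨rfl, rfl, rfl⟩ <;>
    simp <;> ring

theorem tau₄_Labc2_eq_zero {a b c : ℂ} (h : (a = c ∨ a = -c) ∨ (b = c ∨ b = -c)) :
    tau₄ 0 (Labc2 a b c) = 0 := by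
  -- This coordinate equals `x`. In general the quartic has one further term, `(a ^ 2 - c ^ 2) * (b
  -- ^ 2 - c ^ 2) * x ^ 2 * y ^ 2`, which the hypothesis kills.
  refine tau₄_eq_zero_of_hyperdet ![1, 1, 0] (c * (a ^ 2 - b ^ 2)) fun x y => ?_
  simp only [hyperdet, d₁, d₂, d₃, amp_slice, slice_apply, insertNth_zero_vec, Labc2,
    PiLp.add_apply, PiLp.smul_apply, ket_apply, smul_eq_mul]
  rcases h with (rfl | rfl) | (rfl | rfl) <;> simp <;> ring

theorem tau₄_La2b2_eq_zero {a b : ℂ} (h : a = b ∨ a = -b) : tau₄ 0 (La2b2 a b) = 0 := by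
  -- Again the coordinate is `x`; the term that vanishes is `(a ^ 2 - b ^ 2) ^ 2 * x ^ 2 * y ^ 2`.
  refine tau₄_eq_zero_of_hyperdet ![1, 1, 0] (4 * a * b) fun x y => ?_
  simp only [hyperdet, d₁, d₂, d₃, amp_slice, slice_apply, insertNth_zero_vec, La2b2,
    PiLp.add_apply, PiLp.smul_apply, ket_apply, smul_eq_mul]
  rcases h with rfl | rfl <;> simp <;> ring

theorem hyperdet_Lab3 (a b x y : ℂ) :
    hyperdet (x • slice 0 (Lab3 a b) 0 + y • slice 0 (Lab3 a b) 1)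
      = (a ^ 2 - b ^ 2) / 2 * x ^ 4 := by
  obtain ⟨k, hk, hk2⟩ : ∃ k : ℂ, Complex.I / (Real.sqrt 2 : ℂ) = k ∧ k ^ 2 = -(1 / 2) := by
    refine ⟨_, rfl, ?_⟩
    rw [div_pow, Complex.I_sq, ← Complex.ofReal_pow, Real.sq_sqrt (by norm_num)]
    norm_num
  simp only [hyperdet, d₁, d₂, d₃, amp_slice, insertNth_zero_vec, Lab3, hk,
    PiLp.add_apply, PiLp.smul_apply, ket_apply, smul_eq_mul]
  simp
  linear_combination (-(a ^ 2 - b ^ 2) * x ^ 4) * hk2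

theorem tau₄_Lab3_eq_zero {a b : ℂ} (h : ‖a‖ = ‖b‖) : tau₄ 0 (Lab3 a b) = 0 := by
  -- The coordinate is `a * x`, hence the division by `a ^ 4`. The equality of norms enters only at
  -- `a = 0`, where it forces `b = 0`.
  refine tau₄_eq_zero_of_hyperdet ![0, 0, 0] ((a ^ 2 - b ^ 2) / 2 / a ^ 4) fun x y => ?_
  rw [hyperdet_Lab3]
  have e₀ : slice 0 (Lab3 a b) 0 ![0, 0, 0] = a := by
    simp [slice_apply, Lab3, ket_apply]
  have e₁ : slice 0 (Lab3 a b) 1 ![0, 0, 0] = 0 := by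
    simp [slice_apply, Lab3, ket_apply]
  rw [e₀, e₁]
  by_cases ha : a = 0
  · have hb : b = 0 := by simpa [ha, eq_comm] using h
    simp [ha, hb]
  · field_simp
    ring

theorem tau₄_W4 : tau₄ 0 W4 = 0 := by
  refine tau₄_eq_zero_of_hyperdet ![0, 0, 0] 0 fun x y => ?_
  simp [hyperdet, d₁, d₂, d₃, amp_slice, W4, ket_apply]

theorem tau₄_La4_zero : tau₄ 0 (La4 0) = 0 := by
  refine tau₄_eq_zero_of_hyperdet ![1, 1, 0] (-1) fun x y => ?_
  simp [hyperdet, d₁, d₂, d₃, amp_slice, slice_apply, La4, ket_apply,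
    mul_pow]
  ring

theorem tau₄_La2031_zero : tau₄ 0 (La2031 0) = 0 := by
  refine tau₄_eq_zero_of_hyperdet ![0, 0, 0] 0 fun x y => ?_
  simp [hyperdet, d₁, d₂, d₃, amp_slice, La2031, ket_apply]

theorem tau₄_L053 : tau₄ 0 L053 = 0 := by
  refine tau₄_eq_zero_of_hyperdet ![0, 0, 0] 0 fun x y => ?_
  simp [hyperdet, d₁, d₂, d₃, amp_slice, L053, ket_apply]

theorem tau₄_L031031 : tau₄ 0 L031031 = 0 := by
  refine tau₄_eq_zero_of_hyperdet ![0, 0, 0] 1 fun x y => ?_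
  simp [hyperdet, d₁, d₂, d₃, amp_slice, slice_apply, L031031, ket_apply]
  ring

theorem tau₄_L071_of_ne_zero {k : Fin 4} (hk : k ≠ 0) : tau₄ k L071 = 0 := by
  refine tau₄_eq_zero_of_hyperdet ![0, 0, 0] 1 fun x y => ?_
  obtain rfl | rfl | rfl : k = 1 ∨ k = 2 ∨ k = 3 := by omega
  all_goals
    simp [hyperdet, d₁, d₂, d₃, amp_slice, slice_apply, insertNth_one_vec, insertNth_two_vec,
      insertNth_three_vec, L071, ket_apply]
    ring

/-! ### Two realizations with different averages for `L071`. -/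

theorem exists_unit_smul {n : ℕ} (φ : Qubits n) :
    ∃ π : Qubits n, ‖π‖ = 1 ∧ φ = (‖φ‖ : ℂ) • π := by
  by_cases h : φ = 0
  · exact ⟨EuclideanSpace.single 0 1, by simp, by simp [h]⟩
  · have h0 : ‖φ‖ ≠ 0 := norm_ne_zero_iff.mpr h
    refine ⟨((‖φ‖⁻¹ : ℝ) : ℂ) • φ, ?_, ?_⟩
    · rw [norm_smul]
      simp [h0]
    · rw [smul_smul, ← Complex.ofReal_mul, mul_inv_cancel₀ h0]
      simp

theorem hyperdet_smul (c : ℂ) (φ : Qubits 3) : hyperdet (c • φ) = c ^ 4 * hyperdet φ := by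
  simp only [hyperdet, d₁, d₂, d₃, amp, PiLp.smul_apply, smul_eq_mul]
  ring

theorem tau₃Pure_smul (c : ℂ) (φ : Qubits 3) : tau₃Pure (c • φ) = ‖c‖ ^ 2 * tau₃Pure φ := by
  rw [tau₃Pure_of_hyperdet ((hyperdet_smul c φ).trans (mul_comm _ _)), mul_comm]
  rfl

/-- Normalizing is harmless: `τ₃` is homogeneous of degree two, so the weights `‖χ‖ ^ 2` absorb the
norms. -/
theorem add_mem_averages (χ₀ χ₁ : Qubits 3) :
    tau₃Pure χ₀ + tau₃Pure χ₁ ∈ averages (proj χ₀ + proj χ₁) := by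
  obtain ⟨π₀, h₀, e₀⟩ := exists_unit_smul χ₀
  obtain ⟨π₁, h₁, e₁⟩ := exists_unit_smul χ₁
  refine ⟨2, ![‖χ₀‖ ^ 2, ‖χ₁‖ ^ 2], ![π₀, π₁], ⟨?_, ?_, ?_⟩, ?_⟩
  · simp [Fin.forall_fin_two]
  · simp [Fin.forall_fin_two, h₀, h₁]
  · nth_rw 1 [e₀, e₁]
    rw [proj_smul, proj_smul, Fin.sum_univ_two]
    rfl
  · nth_rw 1 [e₀, e₁]
    rw [tau₃Pure_smul, tau₃Pure_smul, Fin.sum_univ_two, Complex.norm_real, Complex.norm_real,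
      norm_norm, norm_norm]
    rfl

theorem tau₄_ne_zero_of_lt {k : Fin 4} {ψ : Qubits 4} {s t : ℝ}
    (hs : s ∈ averages (partialTrace k (proj ψ))) (ht : t ∈ averages (partialTrace k (proj ψ)))
    (h : s < t) : tau₄ k ψ ≠ 0 := by
  have h₁ : tau₃ (partialTrace k (proj ψ)) ≤ s := csInf_le (bddBelow_averages _) hs
  have h₂ : t ≤ tauA (partialTrace k (proj ψ)) := le_csSup (bddAbove_averages _) ht
  have h₀ := tau₃_nonneg (partialTrace k (proj ψ))
  refine (Real.sqrt_pos.mpr (sub_pos.mpr ?_)).ne'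
  exact pow_lt_pow_left₀ (by linarith) h₀ (by norm_num)

/-- The rotation of a two-term realization by the Hadamard matrix. -/
theorem proj_hadamard {n : ℕ} {r : ℂ} (hr : r * starRingEnd ℂ r = 1 / 2) (φ₀ φ₁ : Qubits n) :
    proj (r • φ₀ + r • φ₁) + proj (r • φ₀ + (-r) • φ₁) = proj φ₀ + proj φ₁ := by
  ext i j
  simp only [proj, Matrix.add_apply, PiLp.add_apply, PiLp.smul_apply, smul_eq_mul, map_add,
    map_mul, map_neg]
  linear_combination (2 * φ₀ i * starRingEnd ℂ (φ₀ j) + 2 * φ₁ i * starRingEnd ℂ (φ₁ j)) * hr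

theorem hyperdet_L071 (x y : ℂ) :
    hyperdet (x • slice 0 L071 0 + y • slice 0 L071 1) = 4 * x * y ^ 3 := by
  simp [hyperdet, d₁, d₂, d₃, amp_slice, L071, ket_apply]
  ring

theorem tau₄_L071_ne_zero : tau₄ 0 L071 ≠ 0 := by
  have hφ : ∀ x y : ℂ, tau₃Pure (x • slice 0 L071 0 + y • slice 0 L071 1)
      = Real.sqrt (4 * ‖4 * x * y ^ 3‖) := fun x y => by
    rw [← hyperdet_L071]; rfl
  obtain ⟨r, hr⟩ : ∃ r : ℂ, r * starRingEnd ℂ r = 1 / 2 := by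
    refine ⟨(Real.sqrt (1 / 2) : ℝ), ?_⟩
    rw [Complex.conj_ofReal, ← Complex.ofReal_mul, Real.mul_self_sqrt (by norm_num)]
    norm_num
  have hr0 : r ≠ 0 := by
    rintro rfl
    norm_num at hr
  have m₀ := add_mem_averages (slice 0 L071 0) (slice 0 L071 1)
  have m₁ := add_mem_averages (r • slice 0 L071 0 + r • slice 0 L071 1)
    (r • slice 0 L071 0 + (-r) • slice 0 L071 1)
  rw [proj_hadamard hr] at m₁
  rw [← partialTrace_proj] at m₀ m₁
  refine tau₄_ne_zero_of_lt m₀ m₁ ?_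
  have z₀ : tau₃Pure (slice 0 L071 0) = 0 := by simpa using hφ 1 0
  have z₁ : tau₃Pure (slice 0 L071 1) = 0 := by simpa using hφ 0 1
  rw [z₀, z₁, add_zero]
  -- One rotated vector suffices: its `x` and `y` both equal `r ≠ 0`.
  refine add_pos_of_pos_of_nonneg ?_ (tau₃Pure_nonneg _)
  rw [hφ]
  exact Real.sqrt_pos.mpr (mul_pos (by norm_num) (norm_pos_iff.mpr (by simp [hr0])))

/-! ### The W state in the family `L_{ab₃}`. -/

theorem localOp_four (A : Fin 4 → Matrix (Fin 2) (Fin 2) ℂ) (ψ : Qubits 4) (i : Fin 4 → Fin 2) :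
    localOp A ψ i = ∑ a, ∑ b, ∑ c, ∑ d,
      A 0 (i 0) a * A 1 (i 1) b * A 2 (i 2) c * A 3 (i 3) d * ψ ![a, b, c, d] := by
  let e : (Fin 2 × Fin 2 × Fin 2 × Fin 2) ≃ (Fin 4 → Fin 2) :=
    { toFun := fun q => ![q.1, q.2.1, q.2.2.1, q.2.2.2]
      invFun := fun v => (v 0, v 1, v 2, v 3)
      left_inv := fun q => rfl
      right_inv := fun v => by ext q; fin_cases q <;> rfl }
  simp only [localOp, ← e.sum_comp, Fintype.sum_prod_type, Fin.prod_univ_four]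
  rfl

theorem sloccEquiv_Lab3_W4 : SLOCCEquiv (Lab3 0 0) W4 := by
  have hs : (Real.sqrt 2 : ℂ) ≠ 0 := by simp
  -- Flipping the last two qubits permutes the four kets into those of W; the scalar replaces `i /
  -- √2` by `1 / 2`.
  refine ⟨![(1 / 2 * ((Real.sqrt 2 : ℂ) / Complex.I)) • 1, 1, !![0, 1; 1, 0], !![0, 1; 1, 0]],
    ?_, ?_⟩
  · intro q
    fin_cases q <;> simp [Matrix.det_fin_two]
  · ext v
    obtain ⟨a, b, c, d, rfl⟩ : ∃ a b c d, v = ![a, b, c, d] :=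
      ⟨v 0, v 1, v 2, v 3, by ext q; fin_cases q <;> rfl⟩
    rw [localOp_four]
    fin_cases a <;> fin_cases b <;> fin_cases c <;> fin_cases d <;>
      simp [W4, Lab3, ket_apply, Matrix.one_apply] <;> field_simp <;> simp

end FourQubit

theorem mainTheorem3 :
    -- the family `G_{abcd}`
    (∀ a b c d : ℝ, |a| = |b| → |b| = |c| → |c| = |d| →
      FourQubit.tau₄ 0 (FourQubit.Gabcd a b c d) = 0) ∧
    (∀ a b c d : ℂ, (b = a ∨ b = -a) → (c = a ∨ c = -a) → (d = a ∨ d = -a) →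
      FourQubit.tau₄ 0 (FourQubit.Gabcd a b c d) = 0) ∧
    (∀ a b c d : ℂ,
      ((b = 0 ∧ c = 0 ∧ d = 0) ∨ (a = 0 ∧ c = 0 ∧ d = 0) ∨
        (a = 0 ∧ b = 0 ∧ d = 0) ∨ (a = 0 ∧ b = 0 ∧ c = 0)) →
      FourQubit.tau₄ 0 (FourQubit.Gabcd a b c d) = 0) ∧
    -- the family `L_{abc₂}`
    (∀ a b c : ℝ, (|a| = |c| ∨ |b| = |c|) →
      FourQubit.tau₄ 0 (FourQubit.Labc2 a b c) = 0) ∧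
    (∀ a b c : ℂ, ((a = c ∨ a = -c) ∨ (b = c ∨ b = -c)) →
      FourQubit.tau₄ 0 (FourQubit.Labc2 a b c) = 0) ∧
    -- the family `L_{a₂b₂}`
    (∀ a b : ℝ, |a| = |b| → FourQubit.tau₄ 0 (FourQubit.La2b2 a b) = 0) ∧
    (∀ a b : ℂ, (a = b ∨ a = -b) → FourQubit.tau₄ 0 (FourQubit.La2b2 a b) = 0) ∧
    -- the family `L_{ab₃}`, with the W state
    (∀ a b : ℂ, ‖a‖ = ‖b‖ → FourQubit.tau₄ 0 (FourQubit.Lab3 a b) = 0) ∧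
    FourQubit.SLOCCEquiv (FourQubit.Lab3 0 0) FourQubit.W4 ∧
    FourQubit.tau₄ 0 FourQubit.W4 = 0 ∧
    -- the families `L_{a₄}` and `L_{a₂0_{3⊕1}}` at `a = 0`
    (∀ a : ℂ, a = 0 → FourQubit.tau₄ 0 (FourQubit.La4 a) = 0) ∧
    (∀ a : ℂ, a = 0 → FourQubit.tau₄ 0 (FourQubit.La2031 a) = 0) ∧
    -- `L_{0_{5⊕3̄}}` and `L_{0_{3⊕1̄}0_{3⊕1̄}}`
    FourQubit.tau₄ 0 FourQubit.L053 = 0 ∧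
    FourQubit.tau₄ 0 FourQubit.L031031 = 0 ∧
    -- `L_{0_{7⊕1̄}}`: nonzero for the first qubit, zero for each of the others
    FourQubit.tau₄ 0 FourQubit.L071 ≠ 0 ∧
    (∀ k : Fin 4, k ≠ 0 → FourQubit.tau₄ k FourQubit.L071 = 0) := by
  have real : ∀ {s t : ℝ}, |s| = |t| → (s : ℂ) = t ∨ (s : ℂ) = -t := fun h => by
    rcases abs_eq_abs.mp h with rfl | rfl <;> simp
  refine ⟨fun a b c d hab hbc hcd => FourQubit.tau₄_Gabcd_of_sq_eq (real hab.symm)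
      (real (hab.trans hbc).symm) (real (hab.trans (hbc.trans hcd)).symm),
    fun a b c d => FourQubit.tau₄_Gabcd_of_sq_eq,
    fun a b c d => FourQubit.tau₄_Gabcd_of_three_zero,
    fun a b c h => FourQubit.tau₄_Labc2_eq_zero (h.imp real real),
    fun a b c => FourQubit.tau₄_Labc2_eq_zero,
    fun a b h => FourQubit.tau₄_La2b2_eq_zero (real h),
    fun a b => FourQubit.tau₄_La2b2_eq_zero,
    fun a b => FourQubit.tau₄_Lab3_eq_zero,
    FourQubit.sloccEquiv_Lab3_W4, FourQubit.tau₄_W4,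
    fun a ha => ha ▸ FourQubit.tau₄_La4_zero,
    fun a ha => ha ▸ FourQubit.tau₄_La2031_zero,
    FourQubit.tau₄_L053, FourQubit.tau₄_L031031, FourQubit.tau₄_L071_ne_zero,
    fun k => FourQubit.tau₄_L071_of_ne_zero⟩
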